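/- Let $\mathcal E,\mathcal E'$ be separable complex Hilbert spaces, let $\mathbb D$ be the open unit disc of $\mathbb C$, and let $\mathcal B_1(\mathcal E,\mathcal E')$ be the set of linear contractions from $\mathcal E$ into $\mathcal E'$ (bounded linear operators $T$ with $\|T\|\le 1$). For a contraction $T$ put $D_T=(I-T^*T)^{1/2}$ and let $\mathcal D_T$ be the closure of the range of $D_T$. For $A,B\in\mathcal B_1(\mathcal E,\mathcal E')$, $A$ Shmul'yan dominates $B$ if $B=A+D_{A^*}XD_A$ for some bounded linear $X:\mathcal D_A\to\mathcal D_{A^*}$; $A$ and $B$ are Shmul'yan equivalent if each Shmul'yan dominates the other, and the equivalence classes in $\mathcal B_1(\mathcal E,\mathcal E')$ are called Shmul'yan parts. Let $H_1^\infty(\mathcal E,\mathcal E')$ be the set of all analytic functions $F:\mathbb D\to\mathcal B(\mathcal E,\mathcal E')$ (with respect to the operator norm) such that $\|F(z)\|\le 1$ for all $z\in\mathbb D$. Let $\delta(z,\mu)=\tanh^{-1}\left|\frac{z-\mu}{1-\bar\mu z}\right|$ be the hyperbolic metric on $\mathbb D$, and define the Kobayashi pseudo-distance $$\delta_K(T,T')=\inf\sum_{j=1}^n\delta(0,\lambda_j)\in[0,\infty],$$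 where the infimum is over all $n\ge 1$ and all finite systems $\lambda_1,\dots,\lambda_n\in\mathbb D$ for which there are $F_1,\dots,F_n\in H_1^\infty(\mathcal E,\mathcal E')$ with $F_1(0)=T$, $F_j(\lambda_j)=F_{j+1}(0)$ for $1\le j\le n-1$, and $F_n(\lambda_n)=T'$ (and $\delta_K(T,T')=\infty$ if there is no such system). **Theorem.** Let $T,T'\in\mathcal B_1(\mathcal E,\mathcal E')$. The following are equivalent: (i) $T$ and $T'$ are in the same Shmul'yan part; (ii) there exist $\lambda_0\in\mathbb D$ and $F\in H_1^\infty(\mathcal E,\mathcal E')$ such that $F(0)=T$ and $F(\lambda_0)=T'$; (iii) $\delta_K(T,T')<\infty$. -/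

import Mathlib

open scoped ENNReal InnerProductSpace

noncomputable section

namespace Shmulyan

variable {E E' : Type*}
  [NormedAddCommGroup E] [InnerProductSpace ℂ E] [CompleteSpace E]
  [NormedAddCommGroup E'] [InnerProductSpace ℂ E'] [CompleteSpace E']

variable (E E') in
/-- The set `B₁(E, E')` of linear contractions from `E` into `E'`. -/
def contractions : Set (E →L[ℂ] E') := {T | ‖T‖ ≤ 1}

/-- The defect operator `D_T = (I - T* T)^{1/2}` of a contraction `T`. -/
def defectOp (T : E →L[ℂ] E') : E →L[ℂ] E :=
  CFC.sqrt (1 - ContinuousLinearMap.adjoint T ∘L T)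

/-- The defect space of `T`: the closure of the range of `D_T`. -/
def defectSpace (T : E →L[ℂ] E') : Submodule ℂ E :=
  (LinearMap.range (defectOp T).toLinearMap).topologicalClosure

/-- The defect operator viewed as an operator from `E` into the defect space. -/
def defectOpRestrict (T : E →L[ℂ] E') : E →L[ℂ] defectSpace T :=
  (defectOp T).codRestrict (defectSpace T)
    (fun x => Submodule.le_topologicalClosure _ (LinearMap.mem_range_self _ x))

/-- `Dominates A B`: `A` Shmul'yan dominates `B`, i.e. `B = A + D_{A*} X D_A` for some bounded
operator `X` from the defect space of `A` into the defect space of `A*`. -/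
def Dominates (A B : E →L[ℂ] E') : Prop :=
  ∃ X : defectSpace A →L[ℂ] defectSpace (ContinuousLinearMap.adjoint A),
    B = A + defectOp (ContinuousLinearMap.adjoint A) ∘L
      (defectSpace (ContinuousLinearMap.adjoint A)).subtypeL ∘L X ∘L defectOpRestrict A

/-- Shmul'yan equivalence: each of the two operators Shmul'yan dominates the other. -/
def Equivalent (A B : E →L[ℂ] E') : Prop := Dominates A B ∧ Dominates B A

/-- The Shmul'yan part of `S`: all contractions that are Shmul'yan equivalent to `S`. -/
def part (S : E →L[ℂ] E') : Set (E →L[ℂ] E') :=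
  {B | B ∈ contractions E E' ∧ Equivalent S B}

variable (E E') in
/-- The collection of all Shmul'yan parts of `B₁(E, E')`. -/
def parts : Set (Set (E →L[ℂ] E')) :=
  {P | ∃ S ∈ contractions E E', P = part S}

end Shmulyan

namespace Kobayashi

variable {E E' : Type*}
  [NormedAddCommGroup E] [InnerProductSpace ℂ E]
  [NormedAddCommGroup E'] [InnerProductSpace ℂ E']

variable (E E') in
/-- The operator-valued Schur class `H₁^∞(E, E')`: functions that are analytic on the open unit
disc, in the operator norm, with contractive values there (values off the disc are irrelevant). -/
def schurClass : Set (ℂ → E →L[ℂ] E') :=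
  {F | AnalyticOnNhd ℂ F (Metric.ball 0 1) ∧ ∀ z ∈ Metric.ball (0 : ℂ) 1, ‖F z‖ ≤ 1}

/-- The hyperbolic metric on the open unit disc. -/
def hyperbolicDist (z μ : ℂ) : ℝ :=
  Real.artanh ‖(z - μ) / (1 - (starRingEnd ℂ) μ * z)‖

/-- The system `lam 0, …, lam n` of `n + 1` points of the unit disc is admissible for `(T, T')`:
there are Schur functions `F 0, …, F n` with `F 0 (0) = T`, `F j (lam j) = F (j + 1) (0)` for
`j < n`, and `F n (lam n) = T'`. -/
def IsAdmissible (T T' : E →L[ℂ] E') {n : ℕ} (lam : Fin (n + 1) → ℂ) : Prop :=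
  (∀ j, lam j ∈ Metric.ball (0 : ℂ) 1) ∧
  ∃ F : Fin (n + 1) → ℂ → E →L[ℂ] E',
    (∀ j, F j ∈ schurClass E E') ∧
    F 0 0 = T ∧
    (∀ j : Fin n, F j.castSucc (lam j.castSucc) = F j.succ 0) ∧
    F (Fin.last n) (lam (Fin.last n)) = T'

/-- The Kobayashi pseudo-distance `δ_K(T, T') ∈ [0, ∞]`; it is `∞` when there is no admissible
system. -/
def pseudoDist (T T' : E →L[ℂ] E') : ℝ≥0∞ :=
  ⨅ (n : ℕ) (lam : Fin (n + 1) → ℂ) (_ : IsAdmissible T T' lam),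
    ENNReal.ofReal (∑ j, hyperbolicDist 0 (lam j))

end Kobayashi

end

/-! By `dominates_iff`, `A` dominates `B` exactly when `|⟪y, (B - A) x⟫| ≤ c ‖D_A x‖ ‖D_{A*} y‖`, so
the argument is about inequalities between defect operators. From functions to parts: positivity of
a mean over the circle yields a Schwarz–Pick estimate for `F l - F 0` in terms of the mixed defects
of `F 0` and `(F l)*` (`two_mul_re_inner_le`). `equivalent_of_norm_inner_le` turns it into
equivalence, and transitivity carries this along a chain. From parts to functions: write `B = A +
D_{A*} X D_A`. Since `B` dominates `A`, `ρ ‖X v‖ ≤ ‖(1 - A* X) v‖` for some `ρ > 1`. Hence `Y(μ) = μ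
X (1 - (1 - μ) A* X)⁻¹` gives contractions `A + D_{A*} Y(μ) D_A` for `|μ| < ρ`, equal to `A` at `μ =
0` and to `B` at `μ = 1`; rescaling the disc gives `F`. -/

/-! ### Preliminaries on operators and circle means. -/

open ContinuousLinearMap in
/-- If two positive operators have squares intertwined by `T`, they are intertwined by `T`. -/
theorem ContinuousLinearMap.comp_eq_of_sq_comp_eq {E E' : Type*}
    [NormedAddCommGroup E] [InnerProductSpace ℂ E] [CompleteSpace E]
    [NormedAddCommGroup E'] [InnerProductSpace ℂ E'] [CompleteSpace E']
    {S : E' →L[ℂ] E'} {R : E →L[ℂ] E} (hS : 0 ≤ S) (hR : 0 ≤ R) (T : E →L[ℂ] E')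
    (h : S ∘L S ∘L T = T ∘L R ∘L R) : S ∘L T = T ∘L R := by
  rw [nonneg_iff_isPositive] at hS
  have hR' := (nonneg_iff_isPositive R).1 hR
  set W : E →L[ℂ] E' := S ∘L T - T ∘L R with hW
  have hSa : adjoint S = S := hS.isSelfAdjoint.adjoint_eq
  have hRa : adjoint R = R := hR'.isSelfAdjoint.adjoint_eq
  have hSW : S ∘L W = -(W ∘L R) := by
    rw [hW, comp_sub, sub_comp, h, comp_assoc, comp_assoc]; abel
  set P : E →L[ℂ] E := adjoint W ∘L W with hP
  set Q : E →L[ℂ] E := adjoint W ∘L S ∘L W with hQ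
  have hPpos : 0 ≤ P := (nonneg_iff_isPositive P).2 (isPositive_adjoint_comp_self W)
  have hQpos : 0 ≤ Q := (nonneg_iff_isPositive Q).2 (hS.adjoint_conj W)
  have hPQ : P * R = -Q := by
    change (adjoint W ∘L W) ∘L R = _
    rw [hQ, hSW, comp_neg, neg_neg, comp_assoc]
  have hPa : star P = P := (hPpos.isSelfAdjoint)
  -- `P R = -Q` is self-adjoint, hence `P` and `R` commute; then `P R` is both `≥ 0` and `≤ 0`.
  have hcomm : Commute P R := by
    have h1 : star (P * R) = R * P := by
      rw [star_mul, hPa, (hR.isSelfAdjoint : star R = R)]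
    rw [hPQ, star_neg, (hQpos.isSelfAdjoint : star Q = Q), ← hPQ] at h1
    exact h1
  have hPR : P * R = 0 := by
    refine le_antisymm ?_ (hcomm.mul_nonneg hPpos hR)
    rw [hPQ]; exact neg_nonpos.2 hQpos
  have hWR : W ∘L R = 0 := by
    ext x
    have h2 : P (R x) = 0 := by simpa using congrArg (fun A => A x) hPR
    have h3 : ‖W (R x)‖ ^ 2 = 0 := by
      rw [apply_norm_sq_eq_inner_adjoint_left]
      simp [← hP, h2]
    simpa using h3
  have hSW0 : S ∘L W = 0 := by rw [hSW, hWR, neg_zero]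
  have hP1 : P = -(R ∘L adjoint T ∘L W) := by
    have : adjoint W = adjoint T ∘L S - R ∘L adjoint T := by
      rw [hW, map_sub, adjoint_comp, adjoint_comp, hSa, hRa]
    rw [hP, this, sub_comp, comp_assoc, hSW0, comp_zero, zero_sub, comp_assoc]
  have hPP : P * P = 0 := by
    nth_rewrite 2 [hP1]
    rw [mul_neg, neg_eq_zero]
    change P * (R * (adjoint T ∘L W)) = 0
    rw [← mul_assoc, hPR, zero_mul]
  have hP0 : P = 0 := by
    have : star P * P = 0 := by rw [hPa, hPP]
    exact CStarRing.star_mul_self_eq_zero_iff P |>.1 this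
  have hW0 : W = 0 := by
    ext x
    have h3 : ‖W x‖ ^ 2 = 0 := by
      rw [apply_norm_sq_eq_inner_adjoint_left]
      simp [← hP, hP0]
    simpa using h3
  exact sub_eq_zero.1 hW0

/-- A bounded operator that is bounded below by `c` and invertible stays invertible under
perturbations of norm less than `c`. -/
theorem ContinuousLinearMap.isUnit_of_norm_sub_lt {K : Type*} [NormedAddCommGroup K]
    [NormedSpace ℂ K] [CompleteSpace K] {a b : K →L[ℂ] K} (ha : IsUnit a) {c : ℝ}
    (hc : ∀ v, c * ‖v‖ ≤ ‖a v‖) (hab : ‖b - a‖ < c) : IsUnit b := by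
  obtain ⟨u, rfl⟩ := ha
  have hc0 : 0 < c := (norm_nonneg _).trans_lt hab
  have hinv : ‖(↑u⁻¹ : K →L[ℂ] K)‖ ≤ c⁻¹ := by
    refine opNorm_le_bound _ (by positivity) fun v => ?_
    have h1 := hc ((↑u⁻¹ : K →L[ℂ] K) v)
    have h2 : (u : K →L[ℂ] K) ((↑u⁻¹ : K →L[ℂ] K) v) = v :=
      congrArg (fun A : K →L[ℂ] K => A v) u.mul_inv
    rw [h2] at h1
    rw [inv_mul_eq_div, le_div_iff₀ hc0]
    linarith
  have h3 : ‖-((↑u⁻¹ : K →L[ℂ] K) * (b - u))‖ < 1 := by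
    rw [norm_neg]
    calc _ ≤ ‖(↑u⁻¹ : K →L[ℂ] K)‖ * ‖b - u‖ := norm_mul_le _ _
      _ ≤ c⁻¹ * ‖b - u‖ := by gcongr
      _ < c⁻¹ * c := by gcongr
      _ = 1 := inv_mul_cancel₀ hc0.ne'
  have h4 := isUnit_one_sub_of_norm_lt_one h3
  have h5 : b = u * (1 - -((↑u⁻¹ : K →L[ℂ] K) * (b - u))) := by
    rw [sub_neg_eq_add, mul_add, ← mul_assoc, u.mul_inv]; simp
  rw [h5]
  exact u.isUnit.mul h4

/-- In a continuous family of operators over a preconnected set, all bounded below, either all are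
invertible or none is. -/
theorem ContinuousLinearMap.isUnit_of_isPreconnected {X K : Type*} [TopologicalSpace X]
    [NormedAddCommGroup K] [NormedSpace ℂ K] [CompleteSpace K] {a : X → K →L[ℂ] K}
    (ha : Continuous a) {s : Set X} (hs : IsPreconnected s)
    (hb : ∀ t ∈ s, ∃ c > 0, ∀ v, c * ‖v‖ ≤ ‖a t v‖) {t₀ : X} (ht₀ : t₀ ∈ s)
    (hu : IsUnit (a t₀)) {t : X} (ht : t ∈ s) : IsUnit (a t) := by
  have hopen : IsOpen {t | IsUnit (a t)} := Units.isOpen.preimage ha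
  -- Invertibility is an open condition; the lower bounds make it relatively closed in `s`.
  refine hs.subset_of_closure_inter_subset hopen ⟨t₀, ht₀, hu⟩ ?_ ht
  rintro t₁ ⟨hcl, hts⟩
  obtain ⟨c, hc, hbd⟩ := hb t₁ hts
  have hnhds : {t | ‖a t₁ - a t‖ < c / 2} ∈ nhds t₁ := by
    refine (isOpen_lt (by fun_prop) continuous_const).mem_nhds ?_
    simpa using hc
  obtain ⟨t₂, h2, hu2⟩ := mem_closure_iff_nhds.1 hcl _ hnhds
  refine isUnit_of_norm_sub_lt hu2 (fun v => ?_) h2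
  have h3 : ‖a t₁ v‖ ≤ ‖a t₂ v‖ + c / 2 * ‖v‖ := by
    calc ‖a t₁ v‖ = ‖a t₂ v + (a t₁ - a t₂) v‖ := by simp
      _ ≤ ‖a t₂ v‖ + ‖(a t₁ - a t₂) v‖ := norm_add_le _ _
      _ ≤ ‖a t₂ v‖ + c / 2 * ‖v‖ := by
        gcongr; exact (le_opNorm _ _).trans (by gcongr; exact le_of_lt h2)
  have := hbd v
  linarith

/-- Positivity of the mean over the unit circle of a function built from two analytic functions
and the Cauchy kernel. -/
theorem Complex.re_add_nonneg_of_circle {h g : ℂ → ℂ}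
    (hh : DifferentiableOn ℂ h (Metric.closedBall 0 1))
    (hg : DifferentiableOn ℂ g (Metric.closedBall 0 1)) {w : ℂ} (hw : ‖w‖ < 1)
    (hpos : ∀ z : ℂ, ‖z‖ = 1 → 0 ≤ (h z + z / (z - w) * g z).re) : 0 ≤ (h 0 + g w).re := by
  have hne : ∀ z ∈ Metric.sphere (0 : ℂ) |1|, z - w ≠ 0 := by
    intro z hz h0
    rw [sub_eq_zero.1 h0] at hz
    simp at hz; linarith
  have hsub : Metric.sphere (0 : ℂ) |1| ⊆ Metric.closedBall 0 1 := by
    rw [abs_one]; exact Metric.sphere_subset_closedBall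
  have hih : CircleIntegrable h 0 1 :=
    ContinuousOn.circleIntegrable' (hh.continuousOn.mono hsub)
  have hig : CircleIntegrable (fun z => ((z - 0) / (z - w)) • g z) 0 1 := by
    refine ContinuousOn.circleIntegrable'
      (ContinuousOn.fun_smul ?_ (hg.continuousOn.mono hsub))
    exact ContinuousOn.div (by fun_prop) (by fun_prop) hne
  have hd {f : ℂ → ℂ} (hf : DifferentiableOn ℂ f (Metric.closedBall 0 1)) :
      DiffContOnCl ℂ f (Metric.ball 0 |1|) := by
    rw [abs_one]; exact hf.diffContOnCl_ball le_rfl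
  have h1 := (hd hh).circleAverage
  -- Cauchy's formula: the kernel `z / (z - w)` evaluates `g` at `w`, as the plain mean evaluates
  -- `h` at `0`.
  have h2 := (hd hg).circleAverage_smul_div (w := w) (by simpa using hw)
  have h3 := Real.circleAverage_fun_add hih hig
  rw [h1, h2] at h3
  have h4 := Complex.reCLM.circleAverage_comp_comm (hih.fun_add hig)
  rw [h3] at h4
  rw [← Complex.reCLM_apply, ← h4]
  refine Real.circleAverage_nonneg_of_nonneg fun z hz => ?_
  simpa using hpos z (by simpa using hz)

/-! ### Defect operators and Shmul'yan domination. -/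

namespace Shmulyan

open ContinuousLinearMap

theorem norm_apply_le_of_norm_le_one {V W : Type*} [NormedAddCommGroup V] [NormedSpace ℂ V]
    [NormedAddCommGroup W] [NormedSpace ℂ W] {T : V →L[ℂ] W} (hT : ‖T‖ ≤ 1) (x : V) :
    ‖T x‖ ≤ ‖x‖ := by
  simpa using T.le_of_opNorm_le hT x

variable {E E' : Type*}
  [NormedAddCommGroup E] [InnerProductSpace ℂ E] [CompleteSpace E]
  [NormedAddCommGroup E'] [InnerProductSpace ℂ E'] [CompleteSpace E']

theorem norm_adjoint_le_one {T : E →L[ℂ] E'} (hT : ‖T‖ ≤ 1) : ‖adjoint T‖ ≤ 1 := by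
  rwa [LinearIsometryEquiv.norm_map]

theorem inner_one_sub_adjoint_comp_self (T : E →L[ℂ] E') (x : E) :
    ⟪x, (1 - adjoint T ∘L T) x⟫_ℂ = ((‖x‖ ^ 2 - ‖T x‖ ^ 2 : ℝ) : ℂ) := by
  simp only [sub_apply, one_apply_eq_self, comp_apply, inner_sub_right, adjoint_inner_right,
    inner_self_eq_norm_sq_to_K]
  push_cast
  rfl

theorem one_sub_adjoint_comp_self_nonneg {T : E →L[ℂ] E'} (hT : ‖T‖ ≤ 1) :
    0 ≤ 1 - adjoint T ∘L T := by
  rw [nonneg_iff_isPositive, isPositive_iff_complex]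
  intro x
  have h := inner_one_sub_adjoint_comp_self T x
  rw [← inner_conj_symm, h, Complex.conj_ofReal]
  refine ⟨rfl, ?_⟩
  have := norm_apply_le_of_norm_le_one hT x
  simp only [RCLike.re_to_complex, Complex.ofReal_re, sub_nonneg]
  gcongr

theorem defectOp_nonneg (T : E →L[ℂ] E') : 0 ≤ defectOp T := CFC.sqrt_nonneg _

theorem adjoint_defectOp (T : E →L[ℂ] E') : adjoint (defectOp T) = defectOp T :=
  (((nonneg_iff_isPositive _).1 (defectOp_nonneg T)).isSelfAdjoint).adjoint_eq

theorem defectOp_comp_defectOp {T : E →L[ℂ] E'} (hT : ‖T‖ ≤ 1) :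
    defectOp T ∘L defectOp T = 1 - adjoint T ∘L T :=
  CFC.sqrt_mul_sqrt_self _ (one_sub_adjoint_comp_self_nonneg hT)

theorem inner_defectOp_left (T : E →L[ℂ] E') (x y : E) :
    ⟪defectOp T x, y⟫_ℂ = ⟪x, defectOp T y⟫_ℂ := by
  conv_lhs => rw [← adjoint_defectOp T]
  exact adjoint_inner_left _ _ _

theorem norm_sq_defectOp {T : E →L[ℂ] E'} (hT : ‖T‖ ≤ 1) (x : E) :
    ‖defectOp T x‖ ^ 2 = ‖x‖ ^ 2 - ‖T x‖ ^ 2 := by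
  have h : ⟪defectOp T x, defectOp T x⟫_ℂ = ⟪x, (1 - adjoint T ∘L T) x⟫_ℂ := by
    rw [inner_defectOp_left, ← defectOp_comp_defectOp hT]; rfl
  rw [inner_one_sub_adjoint_comp_self, inner_self_eq_norm_sq_to_K] at h
  exact Complex.ofReal_injective (by push_cast at h ⊢; exact h)

theorem defectOp_adjoint_comp {T : E →L[ℂ] E'} (hT : ‖T‖ ≤ 1) :
    defectOp (adjoint T) ∘L T = T ∘L defectOp T := by
  refine comp_eq_of_sq_comp_eq (defectOp_nonneg _) (defectOp_nonneg _) T ?_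
  rw [← comp_assoc, defectOp_comp_defectOp (norm_adjoint_le_one hT), defectOp_comp_defectOp hT,
    adjoint_adjoint]
  ext x; simp

theorem defectOp_adjoint_apply {T : E →L[ℂ] E'} (hT : ‖T‖ ≤ 1) (x : E) :
    defectOp (adjoint T) (T x) = T (defectOp T x) :=
  congrArg (fun A : E →L[ℂ] E' => A x) (defectOp_adjoint_comp hT)

theorem norm_defectOp_adjoint_apply_le {T : E →L[ℂ] E'} (hT : ‖T‖ ≤ 1) (x : E) :
    ‖defectOp (adjoint T) (T x)‖ ≤ ‖defectOp T x‖ := by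
  rw [defectOp_adjoint_apply hT]; exact norm_apply_le_of_norm_le_one hT _

instance (T : E →L[ℂ] E') : CompleteSpace (defectSpace T) :=
  (Submodule.isClosed_topologicalClosure _).completeSpace_coe

theorem coe_defectOpRestrict (T : E →L[ℂ] E') (x : E) :
    (defectOpRestrict T x : E) = defectOp T x := rfl

theorem denseRange_defectOpRestrict (T : E →L[ℂ] E') : DenseRange (defectOpRestrict T) := by
  intro k
  rw [closure_subtype]
  have h : ((↑) : defectSpace T → E) '' Set.range (defectOpRestrict T) =
      (LinearMap.range (defectOp T).toLinearMap : Set E) := by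
    ext z
    simp [← Set.range_comp, Function.comp_def, coe_defectOpRestrict]
  rw [h]
  exact k.2

/-- A two-sided form of Douglas' factorization lemma. -/
theorem exists_comp_eq_of_norm_inner_le {K K' : Type*}
    [NormedAddCommGroup K] [InnerProductSpace ℂ K] [CompleteSpace K]
    [NormedAddCommGroup K'] [InnerProductSpace ℂ K'] [CompleteSpace K']
    {D : E →L[ℂ] K} {D' : E' →L[ℂ] K'} (hD : DenseRange D) (hD' : DenseRange D')
    (C : E →L[ℂ] E') {c : ℝ} (hC : ∀ x y, ‖⟪y, C x⟫_ℂ‖ ≤ c * ‖D x‖ * ‖D' y‖) :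
    ∃ X : K →L[ℂ] K', ∀ x y, ⟪y, C x⟫_ℂ = ⟪D' y, X (D x)⟫_ℂ := by
  wlog hc : 0 ≤ c generalizing c
  · refine this (c := 0) (fun x y => (hC x y).trans ?_) le_rfl
    gcongr
    exact (not_le.1 hc).le
  -- Testing `hC` at `x = C* y` shows that `C*` factors through `D'`; the adjoint of that factor is
  -- then factored through `D`.
  have hb : ∃ M, ∀ y, ‖(adjoint C).toLinearMap y‖ ≤ M * ‖D'.toLinearMap y‖ := by
    refine ⟨c * ‖D‖, fun y => ?_⟩
    set u := adjoint C y with hu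
    have h1 : ‖u‖ * ‖u‖ ≤ c * ‖D‖ * ‖D' y‖ * ‖u‖ := by
      calc ‖u‖ * ‖u‖ = ‖⟪u, u⟫_ℂ‖ := by simp [inner_self_eq_norm_sq_to_K, sq]
        _ = ‖⟪y, C u⟫_ℂ‖ := by rw [hu, adjoint_inner_left]
        _ ≤ c * ‖D u‖ * ‖D' y‖ := hC u y
        _ ≤ c * (‖D‖ * ‖u‖) * ‖D' y‖ := by gcongr; exact D.le_opNorm u
        _ = _ := by ring
    rcases (norm_nonneg u).eq_or_lt with h0 | h0
    · change ‖u‖ ≤ _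
      rw [← h0]; positivity
    · exact le_of_mul_le_mul_right h1 h0
  set W : K' →L[ℂ] E := (adjoint C).toLinearMap.extendOfNorm D'.toLinearMap
  have hW (y : E') : W (D' y) = adjoint C y :=
    LinearMap.extendOfNorm_eq (e := D'.toLinearMap) hD' hb y
  have hWi (x y) : ⟪D' y, adjoint W x⟫_ℂ = ⟪y, C x⟫_ℂ := by
    rw [adjoint_inner_right, hW, adjoint_inner_left]
  have hb' : ∃ M, ∀ x, ‖(adjoint W).toLinearMap x‖ ≤ M * ‖D.toLinearMap x‖ := by
    refine ⟨c, fun x => ?_⟩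
    set u := adjoint W x with hu
    have h1 : ∀ k, ‖⟪k, u⟫_ℂ‖ ≤ c * ‖D x‖ * ‖k‖ := by
      intro k
      induction k using hD'.induction_on with
      | hp => exact isClosed_le (by fun_prop) (by fun_prop)
      | ih y => rw [hWi]; exact hC x y
    have h2 : ‖u‖ * ‖u‖ ≤ c * ‖D x‖ * ‖u‖ := by
      simpa [inner_self_eq_norm_sq_to_K, sq] using h1 u
    rcases (norm_nonneg u).eq_or_lt with h0 | h0
    · change ‖u‖ ≤ _
      rw [← h0]; positivity
    · exact le_of_mul_le_mul_right h2 h0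
  refine ⟨(adjoint W).toLinearMap.extendOfNorm D.toLinearMap, fun x y => ?_⟩
  have := LinearMap.extendOfNorm_eq (e := D.toLinearMap) hD hb' x
  rw [← hWi]
  exact congrArg (fun v => ⟪D' y, v⟫_ℂ) this.symm

theorem dominates_iff {A B : E →L[ℂ] E'} :
    Dominates A B ↔ ∃ c, 0 ≤ c ∧ ∀ x y,
      ‖⟪y, (B - A) x⟫_ℂ‖ ≤ c * ‖defectOp A x‖ * ‖defectOp (adjoint A) y‖ := by
  constructor
  · rintro ⟨X, rfl⟩
    refine ⟨‖X‖, X.opNorm_nonneg, fun x y => ?_⟩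
    rw [add_sub_cancel_left]
    simp only [comp_apply]
    rw [← inner_defectOp_left]
    refine (norm_inner_le_norm _ _).trans ?_
    rw [mul_comm]
    gcongr
    exact X.le_opNorm _
  · rintro ⟨c, -, hc⟩
    obtain ⟨X, hX⟩ := exists_comp_eq_of_norm_inner_le (denseRange_defectOpRestrict A)
      (denseRange_defectOpRestrict (adjoint A)) (B - A) hc
    refine ⟨X, ?_⟩
    rw [← sub_eq_iff_eq_add']
    ext x
    refine ext_inner_left ℂ fun y => ?_
    rw [hX, comp_apply, ← inner_defectOp_left]
    rfl

theorem Dominates.refl (A : E →L[ℂ] E') : Dominates A A :=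
  dominates_iff.2 ⟨0, le_rfl, fun x y => by simp⟩

theorem Equivalent.symm {A B : E →L[ℂ] E'} (h : Equivalent A B) : Equivalent B A := ⟨h.2, h.1⟩

theorem norm_inner_adjoint (C : E →L[ℂ] E') (x : E) (y : E') :
    ‖⟪x, adjoint C y⟫_ℂ‖ = ‖⟪y, C x⟫_ℂ‖ := by
  rw [adjoint_inner_right, norm_inner_symm]

theorem Dominates.adjoint {A B : E →L[ℂ] E'} (h : Dominates A B) :
    Dominates (adjoint A) (adjoint B) := by
  obtain ⟨c, hc0, hc⟩ := dominates_iff.1 h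
  refine dominates_iff.2 ⟨c, hc0, fun y x => ?_⟩
  rw [← map_sub, norm_inner_adjoint, adjoint_adjoint]
  linarith [hc x y]

/-- Expand `‖A x‖² = ‖B x - (B - A) x‖²` and drop `‖(B - A) x‖²`. -/
theorem norm_sq_defectOp_le {A B : E →L[ℂ] E'} (hA : ‖A‖ ≤ 1) (hB : ‖B‖ ≤ 1) (x : E) :
    ‖defectOp A x‖ ^ 2 ≤ ‖defectOp B x‖ ^ 2 + 2 * ‖⟪B x, (B - A) x⟫_ℂ‖ := by
  have h1 : ‖A x‖ ^ 2 = ‖B x‖ ^ 2 - 2 * RCLike.re ⟪B x, (B - A) x⟫_ℂ + ‖(B - A) x‖ ^ 2 := by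
    rw [← norm_sub_sq]; simp
  have h2 := RCLike.re_le_norm ⟪B x, (B - A) x⟫_ℂ
  rw [norm_sq_defectOp hA, norm_sq_defectOp hB, h1]
  nlinarith [sq_nonneg ‖(B - A) x‖]

theorem Dominates.exists_norm_defectOp_le {A B : E →L[ℂ] E'} (hA : ‖A‖ ≤ 1) (hB : ‖B‖ ≤ 1)
    (h : Dominates B A) : ∃ k, 0 < k ∧ ∀ x, ‖defectOp A x‖ ≤ k * ‖defectOp B x‖ := by
  obtain ⟨c, hc0, hc⟩ := dominates_iff.1 h
  refine ⟨1 + 2 * c, by positivity, fun x => ?_⟩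
  refine le_of_sq_le_sq ?_ (by positivity)
  have h1 := norm_sq_defectOp_le hA hB x
  -- The choice `y = B x` turns `D_{B*}` into `D_B`, because `D_{B*} B = B D_B`.
  have h2 : ‖⟪B x, (B - A) x⟫_ℂ‖ ≤ c * ‖defectOp B x‖ * ‖defectOp B x‖ := by
    rw [← neg_sub A B, neg_apply, inner_neg_right, norm_neg]
    refine (hc x (B x)).trans ?_
    gcongr
    exact norm_defectOp_adjoint_apply_le hB x
  nlinarith [sq_nonneg (c * ‖defectOp B x‖), mul_nonneg hc0 (sq_nonneg ‖defectOp B x‖)]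

theorem Equivalent.dominates_trans {A S B : E →L[ℂ] E'} (hA : ‖A‖ ≤ 1) (hS : ‖S‖ ≤ 1)
    (h : Equivalent A S) (h' : Dominates S B) : Dominates A B := by
  obtain ⟨k, hk, hk'⟩ := h.1.exists_norm_defectOp_le hS hA
  obtain ⟨l, hl, hl'⟩ := h.1.adjoint.exists_norm_defectOp_le
    (norm_adjoint_le_one hS) (norm_adjoint_le_one hA)
  obtain ⟨c, hc0, hc⟩ := dominates_iff.1 h.1
  obtain ⟨d, hd0, hd⟩ := dominates_iff.1 h'
  refine dominates_iff.2 ⟨c + d * k * l, by positivity, fun x y => ?_⟩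
  have h1 : ⟪y, (B - A) x⟫_ℂ = ⟪y, (S - A) x⟫_ℂ + ⟪y, (B - S) x⟫_ℂ := by
    rw [← inner_add_right, ← add_apply, sub_add_sub_cancel']
  rw [h1]
  calc _ ≤ ‖⟪y, (S - A) x⟫_ℂ‖ + ‖⟪y, (B - S) x⟫_ℂ‖ := norm_add_le _ _
    _ ≤ c * ‖defectOp A x‖ * ‖defectOp (ContinuousLinearMap.adjoint A) y‖ +
        d * ‖defectOp S x‖ * ‖defectOp (ContinuousLinearMap.adjoint S) y‖ :=
      add_le_add (hc x y) (hd x y)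
    _ ≤ c * ‖defectOp A x‖ * ‖defectOp (ContinuousLinearMap.adjoint A) y‖ +
        d * (k * ‖defectOp A x‖) * (l * ‖defectOp (ContinuousLinearMap.adjoint A) y‖) := by
      gcongr
      · exact hk' x
      · exact hl' y
    _ = _ := by ring

theorem Equivalent.trans {A S B : E →L[ℂ] E'} (hA : ‖A‖ ≤ 1) (hS : ‖S‖ ≤ 1) (hB : ‖B‖ ≤ 1)
    (h : Equivalent A S) (h' : Equivalent S B) : Equivalent A B :=
  ⟨h.dominates_trans hA hS h'.1, h'.symm.dominates_trans hB hS h.2⟩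

/-- Two contractions are equivalent as soon as their difference is controlled by the defect operator
of the first on one side and that of the adjoint of the second on the other. -/
theorem equivalent_of_norm_inner_le {A B : E →L[ℂ] E'} (hA : ‖A‖ ≤ 1) (hB : ‖B‖ ≤ 1) {s : ℝ}
    (hs : 0 ≤ s) (h : ∀ x y,
      ‖⟪y, (B - A) x⟫_ℂ‖ ≤ s * ‖defectOp A x‖ * ‖defectOp (adjoint B) y‖) :
    Equivalent A B := by
  -- If `a > b`, then `a² ≤ a b + 2 s a b`, and `a` can be divided out.
  have key {a b : ℝ} (ha : 0 ≤ a) (hb : 0 ≤ b) (hab : a ^ 2 ≤ b ^ 2 + 2 * (s * a * b)) :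
      a ≤ (1 + 2 * s) * b := by
    by_contra! hlt
    have hba : b ≤ a := by nlinarith [mul_nonneg hs hb]
    nlinarith [mul_nonneg hs hb, mul_le_mul_of_nonneg_left hba hb]
  have h1 (x : E) : ‖defectOp A x‖ ≤ (1 + 2 * s) * ‖defectOp B x‖ := by
    refine key (norm_nonneg _) (norm_nonneg _) ((norm_sq_defectOp_le hA hB x).trans ?_)
    gcongr
    refine (h x (B x)).trans ?_
    gcongr
    exact norm_defectOp_adjoint_apply_le hB x
  have h2 (y : E') : ‖defectOp (adjoint B) y‖ ≤ (1 + 2 * s) * ‖defectOp (adjoint A) y‖ := by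
    refine key (norm_nonneg _) (norm_nonneg _)
      ((norm_sq_defectOp_le (norm_adjoint_le_one hB) (norm_adjoint_le_one hA) y).trans ?_)
    gcongr
    rw [← map_sub, norm_inner_adjoint, ← neg_sub B A, neg_apply, inner_neg_right, norm_neg]
    refine (h (adjoint A y) y).trans ?_
    have := norm_defectOp_adjoint_apply_le (norm_adjoint_le_one hA) y
    rw [adjoint_adjoint] at this
    rw [mul_right_comm]
    gcongr
  constructor
  · refine dominates_iff.2 ⟨s * (1 + 2 * s), by positivity, fun x y => (h x y).trans ?_⟩
    calc _ ≤ s * ‖defectOp A x‖ * ((1 + 2 * s) * ‖defectOp (adjoint A) y‖) := by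
          gcongr; exact h2 y
      _ = _ := by ring
  · refine dominates_iff.2 ⟨s * (1 + 2 * s), by positivity, fun x y => ?_⟩
    rw [← neg_sub B A, neg_apply, inner_neg_right, norm_neg]
    refine (h x y).trans ?_
    calc _ ≤ s * ((1 + 2 * s) * ‖defectOp B x‖) * ‖defectOp (adjoint B) y‖ := by
          gcongr; exact h1 x
      _ = _ := by ring

end Shmulyan

/-! ### Schwarz–Pick estimate and invariance of parts along chains. -/

namespace Kobayashi

open ContinuousLinearMap Shmulyan ComplexConjugate

/-- Taking `a = t conj z` with `t` real gives a nonnegative quadratic in `t`; its discriminant is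
the claim. -/
theorem norm_le_of_forall_two_mul_re_le {z : ℂ} {p q s : ℝ} (hp : 0 ≤ p) (hq : 0 ≤ q) (hs : 0 ≤ s)
    (h : ∀ a : ℂ, 2 * (a * z).re ≤ p ^ 2 + s ^ 2 * (‖a‖ ^ 2 * q ^ 2)) : ‖z‖ ≤ s * p * q := by
  rcases eq_or_ne z 0 with rfl | hz
  · simp only [norm_zero]; positivity
  have hz' : 0 < ‖z‖ ^ 2 := by positivity
  have h1 (t : ℝ) : 0 ≤ (s ^ 2 * ‖z‖ ^ 2 * q ^ 2) * (t * t) + (-2 * ‖z‖ ^ 2) * t + p ^ 2 := by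
    have h2 := h (t * conj z)
    have h3 : ((t : ℂ) * conj z * z).re = t * ‖z‖ ^ 2 := by
      rw [mul_assoc, ← Complex.normSq_eq_conj_mul_self, Complex.normSq_eq_norm_sq]
      norm_cast
    have h4 : ‖(t : ℂ) * conj z‖ ^ 2 = t * t * ‖z‖ ^ 2 := by
      rw [norm_mul, mul_pow, RCLike.norm_conj, Complex.norm_real, Real.norm_eq_abs, sq_abs, sq]
    rw [h3, h4] at h2
    linarith
  have h2 := discrim_le_zero h1
  rw [discrim] at h2
  have h3 : ‖z‖ ^ 2 * ‖z‖ ^ 2 ≤ ‖z‖ ^ 2 * (s * p * q) ^ 2 := by nlinarith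
  exact le_of_sq_le_sq (le_of_mul_le_mul_left h3 hz') (by positivity)

variable {E E' : Type*}
  [NormedAddCommGroup E] [InnerProductSpace ℂ E] [CompleteSpace E]
  [NormedAddCommGroup E'] [InnerProductSpace ℂ E'] [CompleteSpace E']

theorem two_mul_re_inner_le {G : ℂ → E →L[ℂ] E'}
    (hG : DifferentiableOn ℂ G (Metric.closedBall 0 1))
    (hG1 : ∀ z ∈ Metric.closedBall (0 : ℂ) 1, ‖G z‖ ≤ 1) {w : ℂ} (hw : ‖w‖ < 1) (x : E) (y : E') :
    2 * (⟪y, (G w - G 0) x⟫_ℂ).re ≤ ‖defectOp (G 0) x‖ ^ 2 +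
      ‖w‖ ^ 2 / (1 - ‖w‖ ^ 2) * ‖defectOp (adjoint (G w)) y‖ ^ 2 := by
  have hden : ∀ z ∈ Metric.closedBall (0 : ℂ) 1, 1 - conj w * z ≠ 0 := by
    intro z hz h0
    have hz' : ‖z‖ ≤ 1 := by simpa using hz
    have : ‖conj w * z‖ = 1 := by rw [← sub_eq_zero.1 h0]; simp
    rw [norm_mul, RCLike.norm_conj] at this
    nlinarith [norm_nonneg w, norm_nonneg z]
  have hw2 : 0 < 1 - ‖w‖ ^ 2 := by nlinarith [norm_nonneg w]
  -- The Szegő kernel at `w` minus its mean: `κ` vanishes at `0`, and `conj κ = z / (z - w) - 1` on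
  -- the circle, so means against `conj κ` are values at `w` minus values at `0`.
  set κ : ℂ → ℂ := fun z => (1 - conj w * z)⁻¹ - 1 with hκ
  have hκd : DifferentiableOn ℂ κ (Metric.closedBall 0 1) :=
    (DifferentiableOn.inv (by fun_prop) hden).sub_const 1
  set r : ℝ := ‖w‖ ^ 2 / (1 - ‖w‖ ^ 2) with hr
  have hκ0 : κ 0 = 0 := by simp [hκ]
  have hκw : κ w = (r : ℂ) := by
    have h1 : conj w * w = ((‖w‖ ^ 2 : ℝ) : ℂ) := by
      rw [← Complex.normSq_eq_conj_mul_self, Complex.normSq_eq_norm_sq]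
    rw [hκ]
    simp only
    rw [h1, hr]
    have : ((1 - ‖w‖ ^ 2 : ℝ) : ℂ) ≠ 0 := by exact_mod_cast hw2.ne'
    push_cast at this ⊢
    field_simp
    ring
  have hκc {z : ℂ} (hz : ‖z‖ = 1) : z / (z - w) = conj (κ z) + 1 := by
    have hzz : z * conj z = 1 := by rw [Complex.mul_conj, Complex.normSq_eq_norm_sq, hz]; norm_num
    have hz0 : z ≠ 0 := by rintro rfl; simp at hz
    have h1 : conj z = z⁻¹ := eq_inv_of_mul_eq_one_right hzz
    have h2 : z - w ≠ 0 := by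
      intro h; rw [sub_eq_zero.1 h] at hz; linarith
    rw [hκ]
    simp only [map_sub, map_inv₀, map_one, map_mul, Complex.conj_conj, sub_add_cancel, h1]
    have h3 : 1 - w * z⁻¹ = (z - w) / z := by field_simp
    rw [h3, inv_div]
  have hA := hG1 0 (by simp)
  have hB := hG1 w (by simpa using hw.le)
  set v : E := adjoint (G w) y with hv
  set q : ℂ → E := fun z => x + κ z • v with hq
  have hqd : DifferentiableOn ℂ q (Metric.closedBall 0 1) := (hκd.smul_const v).const_add x
  have hGq : DifferentiableOn ℂ (fun z => G z (q z)) (Metric.closedBall 0 1) := hG.clm_apply hqd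
  have hfd (u : E') : DifferentiableOn ℂ (fun z => ⟪u, G z (q z)⟫_ℂ) (Metric.closedBall 0 1) :=
    (innerSL ℂ u).differentiable.comp_differentiableOn hGq
  set y₀ : E' := G 0 x with hy₀
  -- On the circle the integrand has the real part of `‖y₀ + κ y‖² - 2 ⟪y₀ + κ y, G q⟫ + ‖q‖²`,
  -- which is at least `‖y₀ + κ y - G q‖²` as `G` is contractive. Each `conj κ` is split between `g`
  -- and `h`.
  have main := Complex.re_add_nonneg_of_circle
    (h := fun z => ((‖y₀‖ ^ 2 + ‖x‖ ^ 2 : ℝ) : ℂ) + κ z * (2 * ⟪y₀, y⟫_ℂ + 2 * ⟪x, v⟫_ℂ)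
      - κ z * ((‖y‖ ^ 2 + ‖v‖ ^ 2 : ℝ) : ℂ) - 2 * ⟪y₀, G z (q z)⟫_ℂ + 2 * ⟪y, G z (q z)⟫_ℂ)
    (g := fun z => κ z * ((‖y‖ ^ 2 + ‖v‖ ^ 2 : ℝ) : ℂ) - 2 * ⟪y, G z (q z)⟫_ℂ)
    (by
      have h1 := hfd y₀
      have h2 := hfd y
      fun_prop)
    (by
      have h2 := hfd y
      fun_prop) hw ?_
  · have h1 : q 0 = x := by simp [hq, hκ0]
    have h2 : q w = x + (r : ℂ) • v := by simp [hq, hκw]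
    simp only [h1, h2, hκ0, hκw, map_add, map_smul, inner_add_right, inner_smul_right,
      ← hy₀, inner_self_eq_norm_sq_to_K] at main
    have h3 : ⟪y, G w v⟫_ℂ = ((‖v‖ ^ 2 : ℝ) : ℂ) := by
      rw [← adjoint_inner_left, ← hv, inner_self_eq_norm_sq_to_K]; push_cast; rfl
    rw [h3] at main
    rw [norm_sq_defectOp hA, norm_sq_defectOp (norm_adjoint_le_one hB), sub_apply, inner_sub_right,
      ← hy₀, ← hv]
    have h4 : ((‖y₀‖ : ℂ) ^ 2).re = ‖y₀‖ ^ 2 := by norm_cast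
    have h5 : ((RCLike.ofReal ‖y₀‖ : ℂ)) = (‖y₀‖ : ℂ) := rfl
    simp only [h5, Complex.add_re, Complex.sub_re, Complex.mul_re, Complex.ofReal_re,
      Complex.ofReal_im, Complex.re_ofNat, Complex.im_ofNat,
      zero_mul, mul_zero, sub_zero, add_zero, h4] at main ⊢
    linarith
  · intro z hz
    have hzm : z ∈ Metric.closedBall (0 : ℂ) 1 := by simp [hz]
    rw [hκc hz]
    set k := κ z
    have h1 : ‖y₀ + k • y‖ ^ 2 =
        ‖y₀‖ ^ 2 + 2 * (k * ⟪y₀, y⟫_ℂ).re + ‖k‖ ^ 2 * ‖y‖ ^ 2 := by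
      rw [norm_add_sq (𝕜 := ℂ), inner_smul_right, norm_smul, mul_pow]; rfl
    have h2 : ‖q z‖ ^ 2 = ‖x‖ ^ 2 + 2 * (k * ⟪x, v⟫_ℂ).re + ‖k‖ ^ 2 * ‖v‖ ^ 2 := by
      rw [hq]
      simp only
      rw [norm_add_sq (𝕜 := ℂ), inner_smul_right, norm_smul, mul_pow]; rfl
    have h3 : ‖(y₀ + k • y) - G z (q z)‖ ^ 2 = ‖y₀ + k • y‖ ^ 2
        - 2 * (⟪y₀, G z (q z)⟫_ℂ + conj k * ⟪y, G z (q z)⟫_ℂ).re + ‖G z (q z)‖ ^ 2 := by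
      rw [norm_sub_sq (𝕜 := ℂ), inner_add_left, inner_smul_left]; rfl
    have h4 : ‖G z (q z)‖ ^ 2 ≤ ‖q z‖ ^ 2 := by
      have := norm_apply_le_of_norm_le_one (hG1 z hzm) (q z)
      gcongr
    have h5 : 0 ≤ ‖(y₀ + k • y) - G z (q z)‖ ^ 2 := by positivity
    have h6 : ‖k‖ ^ 2 = k.re * k.re + k.im * k.im := by
      rw [← Complex.normSq_eq_norm_sq, Complex.normSq_apply]
    rw [h1] at h3
    rw [h6] at h2 h3
    simp only [Complex.add_re, Complex.sub_re, Complex.mul_re, Complex.ofReal_re, Complex.conj_re,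
      Complex.conj_im, Complex.add_im, Complex.sub_im, Complex.mul_im, Complex.one_re,
      Complex.one_im,
      Complex.ofReal_im, Complex.re_ofNat, Complex.im_ofNat] at h2 h3 ⊢
    nlinarith [h2, h3, h4, h5]

/-- Schwarz–Pick type estimate for the values of an operator-valued Schur function. -/
theorem exists_norm_inner_sub_le {F : ℂ → E →L[ℂ] E'} (hF : F ∈ schurClass E E') {l : ℂ}
    (hl : l ∈ Metric.ball (0 : ℂ) 1) : ∃ s, 0 ≤ s ∧ ∀ x y,
      ‖⟪y, (F l - F 0) x⟫_ℂ‖ ≤ s * ‖defectOp (F 0) x‖ * ‖defectOp (adjoint (F l)) y‖ := by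
  obtain ⟨r, hr, hr1⟩ := exists_between (show ‖l‖ < 1 by simpa using hl)
  have hr0 : 0 < r := (norm_nonneg l).trans_lt hr
  have hrc : (r : ℂ) ≠ 0 := by exact_mod_cast hr0.ne'
  have hmaps : Set.MapsTo (fun z : ℂ => (r : ℂ) * z) (Metric.closedBall 0 1)
      (Metric.ball 0 1) := by
    intro z hz
    have : ‖z‖ ≤ 1 := by simpa using hz
    simp only [mem_ball_zero_iff, norm_mul, Complex.norm_real, Real.norm_eq_abs, abs_of_pos hr0]
    nlinarith
  have hw : ‖l / r‖ < 1 := by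
    rw [norm_div, Complex.norm_real, Real.norm_eq_abs, abs_of_pos hr0]
    exact (div_lt_one hr0).2 hr
  have hw2 : 0 < 1 - ‖l / r‖ ^ 2 := by nlinarith [norm_nonneg (l / r)]
  have hs : 0 ≤ ‖l / r‖ ^ 2 / (1 - ‖l / r‖ ^ 2) := by positivity
  refine ⟨√(‖l / r‖ ^ 2 / (1 - ‖l / r‖ ^ 2)), Real.sqrt_nonneg _, fun x y => ?_⟩
  refine norm_le_of_forall_two_mul_re_le (norm_nonneg _) (norm_nonneg _) (Real.sqrt_nonneg _)
    fun a => ?_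
  rw [Real.sq_sqrt hs]
  -- Dilating by `r` gives analyticity on the closed disc; scaling `y` by `conj a` supplies the free
  -- parameter `a`.
  have h := two_mul_re_inner_le (G := fun z => F (r * z))
    (hF.1.differentiableOn.comp (by fun_prop) hmaps) (fun z hz => hF.2 _ (hmaps hz)) hw x
    (conj a • y)
  simp only [mul_zero, mul_div_cancel₀ _ hrc, inner_smul_left, Complex.conj_conj, map_smul,
    norm_smul, mul_pow, RCLike.norm_conj] at h
  exact h

theorem equivalent_of_mem_schurClass {F : ℂ → E →L[ℂ] E'} (hF : F ∈ schurClass E E') {l : ℂ}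
    (hl : l ∈ Metric.ball (0 : ℂ) 1) : Equivalent (F 0) (F l) := by
  obtain ⟨s, hs, h⟩ := exists_norm_inner_sub_le hF hl
  exact equivalent_of_norm_inner_le (hF.2 0 (by simp)) (hF.2 l hl) hs h

theorem equivalent_of_isAdmissible {T T' : E →L[ℂ] E'} {n : ℕ} {lam : Fin (n + 1) → ℂ}
    (h : IsAdmissible T T' lam) : Equivalent T T' := by
  obtain ⟨hlam, F, hF, h0, hstep, hlast⟩ := h
  have hn {z : ℂ} (hz : z ∈ Metric.ball (0 : ℂ) 1) (j) : ‖F j z‖ ≤ 1 := (hF j).2 z hz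
  have h00 : (0 : ℂ) ∈ Metric.ball (0 : ℂ) 1 := by simp
  have key (j : Fin (n + 1)) : Equivalent (F 0 0) (F j (lam j)) := by
    induction j using Fin.induction with
    | zero => exact equivalent_of_mem_schurClass (hF 0) (hlam 0)
    | succ j ih =>
      refine ih.trans (hn h00 _) (hn (hlam _) _) (hn (hlam _) _) ?_
      rw [hstep j]
      exact equivalent_of_mem_schurClass (hF _) (hlam _)
  rw [← h0, ← hlast]
  exact key _

end Kobayashi

theorem ContinuousLinearMap.differentiableAt_inverse_one_sub_smul {K : Type*}
    [NormedAddCommGroup K] [NormedSpace ℂ K] [CompleteSpace K] (N : K →L[ℂ] K) {f : ℂ → ℂ} {z : ℂ}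
    (hf : DifferentiableAt ℂ f z) (hu : IsUnit (1 - f z • N)) :
    DifferentiableAt ℂ (fun z => Ring.inverse (1 - f z • N)) z :=
  DifferentiableAt.inverse ((hf.smul_const N).const_sub 1) hu

/-! ### The linear fractional Schur function through two equivalent contractions. -/

namespace Shmulyan

open ContinuousLinearMap

variable {E E' : Type*}
  [NormedAddCommGroup E] [InnerProductSpace ℂ E] [CompleteSpace E]
  [NormedAddCommGroup E'] [InnerProductSpace ℂ E'] [CompleteSpace E']

theorem adjoint_apply_mem_defectSpace {A : E →L[ℂ] E'} (hA : ‖A‖ ≤ 1)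
    (k : defectSpace (adjoint A)) : adjoint A k ∈ defectSpace A := by
  refine map_mem_closure (adjoint A).continuous k.2 ?_
  rintro _ ⟨y, rfl⟩
  refine ⟨adjoint A y, ?_⟩
  have := defectOp_adjoint_apply (norm_adjoint_le_one hA) y
  rwa [adjoint_adjoint] at this

/-- The restriction of `A*` to an operator from the defect space of `A*` to that of `A`. -/
noncomputable def adjointRestrict (A : E →L[ℂ] E') (hA : ‖A‖ ≤ 1) :
    defectSpace (adjoint A) →L[ℂ] defectSpace A :=
  (adjoint A ∘L (defectSpace (adjoint A)).subtypeL).codRestrict (defectSpace A)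
    (adjoint_apply_mem_defectSpace hA)

/-- The operator `A + D_{A*} Y D_A`. -/
noncomputable def perturb (A : E →L[ℂ] E') (Y : defectSpace A →L[ℂ] defectSpace (adjoint A)) :
    E →L[ℂ] E' :=
  A + defectOp (adjoint A) ∘L (defectSpace (adjoint A)).subtypeL ∘L Y ∘L defectOpRestrict A

/-- Reduces contractivity of `perturb A Y` to `‖Y d‖ ≤ ‖d - A* Y d‖`; the cross terms match because
`D_{A*} A = A D_A`. -/
theorem norm_sq_sub_norm_sq_perturb {A : E →L[ℂ] E'} (hA : ‖A‖ ≤ 1)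
    (Y : defectSpace A →L[ℂ] defectSpace (adjoint A)) (x : E) :
    ‖x‖ ^ 2 - ‖perturb A Y x‖ ^ 2 =
      ‖defectOpRestrict A x - adjointRestrict A hA (Y (defectOpRestrict A x))‖ ^ 2 -
        ‖Y (defectOpRestrict A x)‖ ^ 2 := by
  set d := defectOpRestrict A x with hd
  have h1 : perturb A Y x = A x + defectOp (adjoint A) (Y d) := rfl
  have h2 : ⟪A x, defectOp (adjoint A) (Y d)⟫_ℂ = ⟪d, adjointRestrict A hA (Y d)⟫_ℂ := by
    rw [← inner_defectOp_left, defectOp_adjoint_apply hA, ← adjoint_inner_right]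
    rfl
  have h3 := norm_sq_defectOp (norm_adjoint_le_one hA) (Y d : E')
  have h4 : ‖d‖ ^ 2 = ‖x‖ ^ 2 - ‖A x‖ ^ 2 := norm_sq_defectOp hA x
  have h5 : ‖adjointRestrict A hA (Y d)‖ = ‖adjoint A (Y d)‖ := rfl
  have h6 : ‖(Y d : E')‖ = ‖Y d‖ := rfl
  rw [h1, norm_add_sq (𝕜 := ℂ), norm_sub_sq (𝕜 := ℂ), h2, h3, h4, h5, h6]
  ring

/-- If `A` and `B = A + D_{A*} X D_A` are equivalent contractions, then `X` is strictly dominated by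
`1 - A* X`. -/
theorem exists_bounds_of_dominates {A B : E →L[ℂ] E'} (hA : ‖A‖ ≤ 1) (hB : ‖B‖ ≤ 1)
    (h : Dominates B A) {X : defectSpace A →L[ℂ] defectSpace (adjoint A)} (hX : B = perturb A X) :
    ∃ k > 0, ∃ ρ > 1, ∀ v, ‖v‖ ≤ k * ‖v - adjointRestrict A hA (X v)‖ ∧
      ρ * ‖X v‖ ≤ ‖v - adjointRestrict A hA (X v)‖ := by
  obtain ⟨k, hk, hk'⟩ := h.exists_norm_defectOp_le hA hB
  have h1 (v : defectSpace A) :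
      ‖v‖ ^ 2 ≤ k ^ 2 * (‖v - adjointRestrict A hA (X v)‖ ^ 2 - ‖X v‖ ^ 2) := by
    induction v using (denseRange_defectOpRestrict A).induction_on with
    | hp => exact isClosed_le (by fun_prop) (by fun_prop)
    | ih x =>
      rw [← norm_sq_sub_norm_sq_perturb hA, ← hX, ← norm_sq_defectOp hB, ← mul_pow]
      exact pow_le_pow_left₀ (norm_nonneg _) (hk' x) 2
  -- Chosen so that `a ‖X v‖² ≤ k⁻² ‖v‖²`, which `h1` bounds by the gap; then `ρ² = 1 + a`.
  set a : ℝ := (k ^ 2 * (‖X‖ ^ 2 + 1))⁻¹ with ha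
  have ha0 : 0 < a := by positivity
  refine ⟨k, hk, √(1 + a), by rw [gt_iff_lt, Real.lt_sqrt] <;> linarith, fun v => ⟨?_, ?_⟩⟩
  · refine le_of_sq_le_sq ?_ (by positivity)
    rw [mul_pow]
    refine (h1 v).trans ?_
    gcongr
    linarith [sq_nonneg ‖X v‖]
  · refine le_of_sq_le_sq ?_ (by positivity)
    rw [mul_pow, Real.sq_sqrt (by positivity)]
    have h2 : ‖X v‖ ^ 2 ≤ (‖X‖ ^ 2 + 1) * ‖v‖ ^ 2 := by
      have := pow_le_pow_left₀ (norm_nonneg _) (X.le_opNorm v) 2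
      nlinarith [sq_nonneg ‖v‖]
    have h3 : a * ‖X v‖ ^ 2 ≤ ‖v - adjointRestrict A hA (X v)‖ ^ 2 - ‖X v‖ ^ 2 := by
      calc a * ‖X v‖ ^ 2 ≤ a * ((‖X‖ ^ 2 + 1) * (k ^ 2 *
            (‖v - adjointRestrict A hA (X v)‖ ^ 2 - ‖X v‖ ^ 2))) := by
            gcongr; exact h2.trans (by gcongr; exact h1 v)
        _ = _ := by rw [ha]; field_simp
    linarith

/-- Equivalent contractions are values of one Schur function, given by an operator linear fractional
map. -/
theorem Equivalent.exists_mem_schurClass {A B : E →L[ℂ] E'} (hA : ‖A‖ ≤ 1) (hB : ‖B‖ ≤ 1)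
    (h : Equivalent A B) : ∃ l ∈ Metric.ball (0 : ℂ) 1, ∃ F ∈ Kobayashi.schurClass E E',
      F 0 = A ∧ F l = B := by
  obtain ⟨X, hX⟩ := h.1
  obtain ⟨k, hk, ρ, hρ, hbd⟩ := exists_bounds_of_dominates hA hB h.2 hX
  have hρ0 : 0 < ρ := by linarith
  have hρc : (ρ : ℂ) ≠ 0 := by exact_mod_cast hρ0.ne'
  set N : defectSpace A →L[ℂ] defectSpace A := adjointRestrict A hA ∘L X with hN
  have hNX (v) : ‖N v‖ ≤ ‖X v‖ := norm_apply_le_of_norm_le_one (norm_adjoint_le_one hA) (X v : E')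
  set a : ℂ → defectSpace A →L[ℂ] defectSpace A := fun μ => 1 - (1 - μ) • N with ha
  have hav (μ v) : a μ v = (v - N v) + μ • N v := by
    simp only [ha, sub_apply, one_apply_eq_self, smul_apply, sub_smul, one_smul]
    abel
  have ha1 : a 1 = 1 := by
    ext v
    rw [hav, one_smul, sub_add_cancel, one_apply_eq_self]
  -- A lower bound alone does not give surjectivity; connectedness of the disc to `a 1 = 1` does.
  have hunit {μ : ℂ} (hμ : μ ∈ Metric.ball (0 : ℂ) ρ) : IsUnit (a μ) := by
    refine isUnit_of_isPreconnected (by fun_prop) (convex_ball (0 : ℂ) ρ).isPreconnected ?_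
      (t₀ := 1) (by simpa using hρ) (ha1 ▸ isUnit_one) hμ
    intro μ hμ
    have hμ' : ‖μ‖ < ρ := by simpa using hμ
    have hpos : 0 < 1 - ‖μ‖ / ρ := by rw [sub_pos, div_lt_one hρ0]; exact hμ'
    refine ⟨(1 - ‖μ‖ / ρ) / k, by positivity, fun v => ?_⟩
    obtain ⟨h1, h2⟩ := hbd v
    have h3 : ‖μ • N v‖ ≤ ‖μ‖ / ρ * ‖v - N v‖ := by
      rw [norm_smul, div_mul_eq_mul_div, mul_div_assoc]
      gcongr
      rw [le_div_iff₀ hρ0, mul_comm]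
      exact (mul_le_mul_of_nonneg_left (hNX v) hρ0.le).trans h2
    have h4 : ‖v - N v‖ ≤ ‖a μ v‖ + ‖μ • N v‖ := by
      rw [hav]; exact norm_le_add_norm_add _ _
    calc (1 - ‖μ‖ / ρ) / k * ‖v‖ ≤ (1 - ‖μ‖ / ρ) / k * (k * ‖v - N v‖) := by gcongr; exact h1
      _ = (1 - ‖μ‖ / ρ) * ‖v - N v‖ := by field_simp
      _ ≤ _ := by linarith
  set Y : ℂ → defectSpace A →L[ℂ] defectSpace (adjoint A) :=
    fun μ => μ • (X ∘L Ring.inverse (a μ)) with hY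
  have hmaps : Set.MapsTo (fun z : ℂ => (ρ : ℂ) * z) (Metric.ball 0 1) (Metric.ball 0 ρ) := by
    intro z hz
    have : ‖z‖ < 1 := by simpa using hz
    simp only [mem_ball_zero_iff, norm_mul, Complex.norm_real, Real.norm_eq_abs, abs_of_pos hρ0]
    nlinarith
  refine ⟨(ρ : ℂ)⁻¹, ?_, fun z => perturb A (Y (ρ * z)), ⟨?_, ?_⟩, ?_, ?_⟩
  · rw [mem_ball_zero_iff, norm_inv, Complex.norm_real, Real.norm_eq_abs, abs_of_pos hρ0]
    exact inv_lt_one_of_one_lt₀ hρ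
  · refine DifferentiableOn.analyticOnNhd (fun z hz => ?_) Metric.isOpen_ball
    refine DifferentiableAt.differentiableWithinAt ?_
    have h1 : DifferentiableAt ℂ (fun z : ℂ => Ring.inverse (a (ρ * z))) z :=
      differentiableAt_inverse_one_sub_smul N
        ((differentiableAt_id.const_mul (ρ : ℂ)).const_sub 1) (hunit (hmaps hz))
    have h2 : DifferentiableAt ℂ (fun z : ℂ => Y (ρ * z)) z :=
      (differentiableAt_id.const_mul (ρ : ℂ)).fun_smul ((differentiableAt_const X).clm_comp h1)
    exact ((differentiableAt_const _).clm_comp ((differentiableAt_const _).clm_comp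
      (h2.clm_comp (differentiableAt_const _)))).const_add A
  · intro z hz
    have hμ := hmaps hz
    set μ : ℂ := ρ * z
    have hμ' : ‖μ‖ < ρ := mem_ball_zero_iff.1 hμ
    refine opNorm_le_bound _ zero_le_one fun x => ?_
    rw [one_mul]
    refine le_of_sq_le_sq ?_ (norm_nonneg _)
    rw [← sub_nonneg, norm_sq_sub_norm_sq_perturb hA, sub_nonneg]
    set d := defectOpRestrict A x
    set v := Ring.inverse (a μ) d with hv
    have h1 : a μ v = d := congrArg (fun C : defectSpace A →L[ℂ] defectSpace A => C d)
      (Ring.mul_inverse_cancel _ (hunit hμ))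
    have h2 : Y μ d = μ • X v := rfl
    -- With `d = a μ v` the terms `μ N v` cancel, leaving `‖μ X v‖ ≤ ‖v - N v‖`, which holds as `|μ|
    -- < ρ`.
    have h3 : d - adjointRestrict A hA (Y μ d) = v - N v := by
      rw [h2, map_smul, ← h1, hav]; exact add_sub_cancel_right _ _
    rw [h3, h2, norm_smul]
    refine pow_le_pow_left₀ (by positivity) (le_trans ?_ (hbd v).2) 2
    gcongr
  · have : Y (ρ * 0) = 0 := by
      ext d : 1
      rw [mul_zero, hY]
      exact zero_smul ℂ (X (Ring.inverse (a 0) d))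
    simp only [this]
    ext x; simp [perturb]
  · have : Y (ρ * (ρ : ℂ)⁻¹) = X := by
      ext d : 1
      rw [mul_inv_cancel₀ hρc, hY]
      simp only [ha1, Ring.inverse_one, one_smul]
      rfl
    simp only [this]
    exact hX.symm

end Shmulyan

/-! ### The equivalences. -/

theorem mainTheorem5
    {E E' : Type*}
    [NormedAddCommGroup E] [InnerProductSpace ℂ E] [CompleteSpace E]
    [TopologicalSpace.SeparableSpace E]
    [NormedAddCommGroup E'] [InnerProductSpace ℂ E'] [CompleteSpace E']
    [TopologicalSpace.SeparableSpace E']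
    (T T' : E →L[ℂ] E')
    (hT : T ∈ Shmulyan.contractions E E') (hT' : T' ∈ Shmulyan.contractions E E') :
    List.TFAE
      [∃ P ∈ Shmulyan.parts E E', T ∈ P ∧ T' ∈ P,
       ∃ lam₀ ∈ Metric.ball (0 : ℂ) 1, ∃ F ∈ Kobayashi.schurClass E E',
         F 0 = T ∧ F lam₀ = T',
       Kobayashi.pseudoDist T T' < ⊤] := by
  have hpd : Kobayashi.pseudoDist T T' < ⊤ ↔
      ∃ (n : ℕ) (lam : Fin (n + 1) → ℂ), Kobayashi.IsAdmissible T T' lam := by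
    simp [Kobayashi.pseudoDist, iInf_lt_iff]
  tfae_have 1 → 2 := by
    rintro ⟨_, ⟨S, hS, rfl⟩, h, h'⟩
    exact (h.2.symm.trans hT hS hT' h'.2).exists_mem_schurClass hT hT'
  tfae_have 2 → 3 := by
    rintro ⟨l, hl, F, hF, h0, h1⟩
    -- Systems have `n + 1` points, so `n = 0` is a single function.
    exact hpd.2 ⟨0, fun _ => l, fun _ => hl, fun _ => F, fun _ => hF, h0, fun j => j.elim0, h1⟩
  tfae_have 3 → 1 := by
    intro h
    obtain ⟨n, lam, hadm⟩ := hpd.1 h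
    exact ⟨Shmulyan.part T, ⟨T, hT, rfl⟩, ⟨hT, .refl T, .refl T⟩,
      ⟨hT', Kobayashi.equivalent_of_isAdmissible hadm⟩⟩
  tfae_finish
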